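/- Let $H_1,\dots,H_n$ be hypotheses with $[0,1]$-valued p-values $p_1,\dots,p_n$ defined on a common probability space, and let $\mathcal H_0\subseteq[n]=\{1,\dots,n\}$ be the set of indices of the true null hypotheses. For $k\in[n]$ let $p_{(k)}$ be the $k$-th smallest p-value (counted with multiplicity) and let $\mathcal R_k=\{j\in[n] : p_j\le p_{(k)}\}$ be the sorted (Benjamini–Hochberg) path. For $\mathcal R\subseteq[n]$ the false discovery proportion is $\mathrm{FDP}(\mathcal R)=|\mathcal R\cap\mathcal H_0|/|\mathcal R|$, with $\mathrm{FDP}(\varnothing)=0$. For $\alpha\in(0,1)$ put $$\overline V_{\mathrm{sort}}(\mathcal R_k)=\left\lfloor\frac{\log(1/\alpha)}{\log\bigl(1+\log(1/\alpha)\bigr)}\,\bigl(1+n\,p_{(k)}\bigr)\right\rfloor,\qquad \overline{\mathrm{FDP}}_{\mathrm{sort}}(\mathcal R_k)=\frac{\overline V_{\mathrm{sort}}(\mathcal R_k)}{|\mathcal R_k|}.$$ Suppose that the null p-values $(p_j)_{j\in\mathcal H_0}$ are mutually independent and stochastically larger than uniform, i.e. $\mathbb P(p_j\le s)\le s$ for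 all $j\in\mathcal H_0$ and $s\in[0,1]$; nothing is assumed about the distribution of the non-null p-values or about their dependence on each other and on the null ones. Then for every $\alpha\in(0,0.31]$, $$\mathbb P\bigl(\mathrm{FDP}(\mathcal R_k)\le\overline{\mathrm{FDP}}_{\mathrm{sort}}(\mathcal R_k)\ \text{for all } k\in[n]\bigr)\ge 1-\alpha .$$ -/

import Mathlib

open MeasureTheory ProbabilityTheory

noncomputable section

namespace SimultaneousFDP

/-- The order statistics of `p = (p_1, …, p_n)`: `Tuple.sort p` is the permutation that sorts `p`
into nondecreasing order. Indices start at `0`, so `orderStat p k` is the `(k+1)`-st smallest of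
the values, counted with multiplicity. -/
def orderStat {n : ℕ} (p : Fin n → ℝ) (k : Fin n) : ℝ :=
  p (Tuple.sort p k)

/-- The rejection sets `R_k = {j : p_j ≤ p_(k)}` of the sorted path. -/
def sortedPath {n : ℕ} (p : Fin n → ℝ) (k : Fin n) : Finset (Fin n) :=
  Finset.univ.filter fun j => p j ≤ orderStat p k

/-- False discovery proportion `|R ∩ H₀| / |R|` of a rejection set `R`. Division by zero
in `ℝ` gives the usual convention `FDP(∅) = 0`. -/
def FDP {n : ℕ} (H₀ R : Finset (Fin n)) : ℝ :=
  ((R ∩ H₀).card : ℝ) / (R.card : ℝ)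

/-- `⌊ log(1/α) / log(1 + log(1/α)) * (1 + n p_(k)) ⌋`. -/
def VbarSort {n : ℕ} (α : ℝ) (p : Fin n → ℝ) (k : Fin n) : ℤ :=
  ⌊Real.log (1 / α) / Real.log (1 + Real.log (1 / α)) * (1 + (n : ℝ) * orderStat p k)⌋

/-- The bound on the false discovery proportion of `R_k`: `VbarSort / |R_k|`. -/
def FDPbarSort {n : ℕ} (α : ℝ) (p : Fin n → ℝ) (k : Fin n) : ℝ :=
  (VbarSort α p k : ℝ) / ((sortedPath p k).card : ℝ)

end SimultaneousFDP

end

namespace SimultaneousFDP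

/-! Write `u = log (1/α)`, `c = u / log (1 + u)`, and let N(s) count the null p-values at most `s`.
A failure of the bound gives N(s) = a > c(1 + ns) at some order statistic `s`. With `t a` solving a
= c(1 + n `t a`), we get s < `t a`, so N reaches `a` at the deterministic point `t a`. Such
crossings are controlled by (1 + β/s)^N(s), a reverse martingale for uniform p-values
(`mul_measureReal_exists_le_countLE_le`). Instead of optional stopping, its proof expands the power
over subsets and uses independence for each subset. With β = g/n the expectation bound is at most
e^g, while `exists_add_le_mul_log_one_add_div` makes the value at every crossing at least e^(u+g).
The ratio is e^(-u) = α. -/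

/-! ### Calculus: the choice of `g`. -/

/-- `log (1 + w)` lies above the multiple of `w / (w + g)` that meets it at `0` and touches it
at `u`. -/
lemma mul_div_add_le_log_one_add {u g κ : ℝ} (hu : 0 < u) (hg : 0 < g)
    (hval : κ * u = (u + g) * Real.log (1 + u)) (htan : (u + g) ^ 2 = κ * g * (1 + u))
    {w : ℝ} (hw : 0 ≤ w) : κ * (w / (w + g)) ≤ Real.log (1 + w) := by
  set D : ℝ → ℝ := fun x => Real.log (1 + x) - κ * (x / (x + g)) with hD
  set D' : ℝ → ℝ := fun x => 1 / (1 + x) - κ * ((1 * (x + g) - x * 1) / (x + g) ^ 2) with hD'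
  have hder : ∀ x, 0 ≤ x → HasDerivAt D (D' x) x := by
    intro x hx
    have h1 : HasDerivAt (fun x : ℝ => Real.log (1 + x)) (1 / (1 + x)) x :=
      ((hasDerivAt_id x).const_add 1).log (by simp only [id]; positivity)
    have h2 : HasDerivAt (fun x : ℝ => x / (x + g)) ((1 * (x + g) - x * 1) / (x + g) ^ 2) x :=
      (hasDerivAt_id x).div ((hasDerivAt_id x).add_const g) (by positivity)
    exact h1.sub (h2.const_mul κ)
  have hcont : ∀ a b, 0 ≤ a → ContinuousOn D (Set.Icc a b) := fun a b ha x hx =>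
    (hder x (ha.trans hx.1)).continuousAt.continuousWithinAt
  -- the other root of the numerator of the derivative
  set r : ℝ := κ * g - 2 * g - u with hr
  have hfac : ∀ x, 0 ≤ x → D' x * ((1 + x) * (x + g) ^ 2) = (x - u) * (x - r) := by
    intro x hx
    have h1 : (1 + x) ≠ 0 := by positivity
    have h2 : (x + g) ≠ 0 := by positivity
    simp only [hD', hr]
    field_simp
    linear_combination htan
  have hpos : ∀ x, 0 ≤ x → 0 < (1 + x) * (x + g) ^ 2 := fun x hx => by positivity
  have h0 : D 0 = 0 := by simp [hD]
  have hDu : D u = 0 := by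
    have h2 : (u + g) ≠ 0 := by positivity
    simp only [hD]
    field_simp
    linarith
  suffices 0 ≤ D w by simp only [hD] at this; linarith
  -- `D` vanishes at `0` and `u`, and `D'` has the sign of `(x - u) * (x - r)`. A negative value
  -- before `u` would make `D'` change from negative to positive left of `u`, against this sign
  -- pattern. Past `u`, Rolle puts `r` in `(0, u)`, so `D` increases there.
  by_contra! hneg
  have mvt : ∀ a b, 0 ≤ a → a < b → ∃ x ∈ Set.Ioo a b, D' x = (D b - D a) / (b - a) :=
    fun a b ha hab => exists_hasDerivAt_eq_slope D D' hab (hcont a b ha)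
      fun x hx => hder x (ha.trans hx.1.le)
  have hw0 : 0 < w := hw.lt_of_ne (by rintro rfl; linarith)
  have hwu : w ≠ u := by rintro rfl; linarith
  rcases lt_or_gt_of_ne hwu with h | h
  · obtain ⟨x, ⟨hx1, hx2⟩, hx⟩ := mvt 0 w le_rfl hw0
    obtain ⟨y, ⟨hy1, hy2⟩, hy⟩ := mvt w u hw h
    have hx' : D' x < 0 := by
      rw [hx, h0]; exact div_neg_of_neg_of_pos (by linarith) (by linarith)
    have hy' : 0 < D' y := by
      rw [hy, hDu]; exact div_pos (by linarith) (by linarith)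
    have hx3 := mul_neg_of_neg_of_pos hx' (hpos x hx1.le)
    have hy3 := mul_pos hy' (hpos y (by linarith))
    rw [hfac x hx1.le] at hx3
    rw [hfac y (by linarith)] at hy3
    have : r < x := by by_contra! hc; nlinarith
    have : y < r := by by_contra! hc; nlinarith
    linarith
  · obtain ⟨x, ⟨hx1, hx2⟩, hx⟩ := mvt 0 u le_rfl hu
    obtain ⟨y, ⟨hy1, hy2⟩, hy⟩ := mvt u w hu.le h
    have hy' : D' y < 0 := by
      rw [hy, hDu]; exact div_neg_of_neg_of_pos (by linarith) (by linarith)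
    have hx3 := hfac x hx1.le
    rw [hx, hDu, h0] at hx3
    have hy3 := mul_neg_of_neg_of_pos hy' (hpos y (by linarith))
    rw [hfac y (by linarith)] at hy3
    have : x = r := by
      have : (x - u) * (x - r) = 0 := by rw [← hx3]; simp
      rcases mul_eq_zero.1 this with h | h <;> linarith
    nlinarith

/-- With `c = u / log (1 + u)`, a suitable `g` makes `(1 + g / s) ^ (c * (1 + s))` at least
`exp (u + g)` for all `s > 0`. -/
lemma exists_add_le_mul_log_one_add_div {u : ℝ} (hu : 0 < u) :
    ∃ g : ℝ, 0 < g ∧ ∀ s : ℝ, 0 < s →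
      u + g ≤ u / Real.log (1 + u) * (1 + s) * Real.log (1 + g / s) := by
  have hl : 0 < Real.log (1 + u) := Real.log_pos (by linarith)
  set c := u / Real.log (1 + u) with hc
  have hcl : c * Real.log (1 + u) = u := div_mul_cancel₀ _ hl.ne'
  have hc0 : 0 < c := by positivity
  have hcu : c < 1 + u := by
    have hs := Real.log_lt_sub_one_of_pos (x := (1 + u)⁻¹) (by positivity)
      (by rw [Ne, inv_eq_one]; linarith)
    rw [Real.log_inv] at hs
    have h1 : u / (1 + u) < Real.log (1 + u) := by
      have : u / (1 + u) = 1 - (1 + u)⁻¹ := by field_simp; ring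
      linarith
    rw [hc, div_lt_iff₀ hl]
    rw [div_lt_iff₀ (by linarith)] at h1
    linarith
  have hd : 0 < 1 + u - c := by linarith
  -- Solves the tangency condition at `w = u` when `κ = (u + g) / c`; positive because `c < 1 + u`.
  set g := c * u / (1 + u - c) with hg
  have hg0 : 0 < g := by positivity
  have hgc : g * (1 + u - c) = c * u := div_mul_cancel₀ _ hd.ne'
  refine ⟨g, hg0, fun s hs => ?_⟩
  have key := mul_div_add_le_log_one_add (κ := (u + g) / c) hu hg0
    (by field_simp; linear_combination -hcl)
    (by field_simp; linear_combination -hgc) (w := g / s) (by positivity)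
  have : (u + g) / c * (g / s / (g / s + g)) = (u + g) / (c * (1 + s)) := by
    field_simp
  rw [this, div_le_iff₀ (by positivity)] at key
  linarith

/-! ### Maximal inequality for the counting function. -/

section crossing

variable {Ω ι : Type*} [MeasurableSpace Ω] [Fintype ι]

/-- The number of coordinates of `x` that are at most `s`. -/
noncomputable def countLE (x : ι → ℝ) (s : ℝ) : ℕ :=
  (Finset.univ.filter fun i => x i ≤ s).card

/-- The points `x` whose counting function reaches `k` at `t k`, but reaches no larger level
`l ∈ J` at `t l`. -/
def lastCrossing (J : Finset ℕ) (t : ℕ → ℝ) (k : ℕ) : Set (ι → ℝ) :=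
  {x | k ≤ countLE x (t k) ∧ ∀ l ∈ J, k < l → countLE x (t l) < l}

lemma measurable_countLE (s : ℝ) : Measurable fun x : ι → ℝ => countLE x s := by
  simp only [countLE, Finset.card_filter]
  refine Finset.measurable_sum _ fun i _ => Measurable.ite ?_ measurable_const measurable_const
  exact measurableSet_le (measurable_pi_apply i) measurable_const

lemma measurableSet_lastCrossing (J : Finset ℕ) (t : ℕ → ℝ) (k : ℕ) :
    MeasurableSet (lastCrossing J t k : Set (ι → ℝ)) := by
  refine (measurableSet_le measurable_const (measurable_countLE _)).inter ?_
  have : {x : ι → ℝ | ∀ l ∈ J, k < l → countLE x (t l) < l}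
      = ⋂ l ∈ J, ⋂ _ : k < l, {x : ι → ℝ | countLE x (t l) < l} := by
    ext; simp
  rw [show (fun x : ι → ℝ => ∀ l ∈ J, k < l → countLE x (t l) < l)
    = {x : ι → ℝ | ∀ l ∈ J, k < l → countLE x (t l) < l} from rfl, this]
  exact Finset.measurableSet_biInter _ fun l _ => MeasurableSet.iInter fun _ =>
    measurableSet_lt (measurable_countLE _) measurable_const

lemma disjoint_lastCrossing {J : Finset ℕ} {t : ℕ → ℝ} {k l : ℕ} (hk : k ∈ J) (hl : l ∈ J)
    (hkl : k ≠ l) : Disjoint (lastCrossing J t k : Set (ι → ℝ)) (lastCrossing J t l) := by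
  rw [Set.disjoint_left]
  rintro x ⟨h1, h2⟩ ⟨h3, h4⟩
  rcases lt_or_gt_of_ne hkl with h | h
  · exact absurd h3 (h2 l hl h).not_ge
  · exact absurd h1 (h4 k hk h).not_ge

lemma exists_mem_lastCrossing {J : Finset ℕ} {t : ℕ → ℝ} {x : ι → ℝ}
    (h : ∃ k ∈ J, k ≤ countLE x (t k)) : ∃ k ∈ J, x ∈ lastCrossing J t k := by
  obtain ⟨k, hk, hmax⟩ := (J.filter fun k => k ≤ countLE x (t k)).exists_maximal
    (by obtain ⟨k, hk, h⟩ := h; exact ⟨k, Finset.mem_filter.2 ⟨hk, h⟩⟩)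
  rw [Finset.mem_filter] at hk
  refine ⟨k, hk.1, hk.2, fun l hl hkl => ?_⟩
  by_contra! hc
  exact absurd (hmax (Finset.mem_filter.2 ⟨hl, hc⟩) hkl.le) hkl.not_ge

/-- Setting coordinates below `t k` to zero does not affect membership in `lastCrossing J t k`. -/
lemma piecewise_zero_mem_lastCrossing [DecidableEq ι] {J : Finset ℕ} {t : ℕ → ℝ}
    (ht : MonotoneOn t J) (ht0 : ∀ k ∈ J, 0 < t k) {k : ℕ} (hk : k ∈ J) {S : Finset ι} {x : ι → ℝ}
    (hx : x ∈ lastCrossing J t k) (hS : ∀ i ∈ S, x i ≤ t k) :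
    S.piecewise (0 : ι → ℝ) x ∈ lastCrossing J t k := by
  have heq : ∀ s, t k ≤ s → countLE (S.piecewise (0 : ι → ℝ) x) s = countLE x s := by
    intro s hs
    simp only [countLE]
    congr 1
    ext i
    by_cases hi : i ∈ S
    · simp [hi, (hS i hi).trans hs, (ht0 k hk).le.trans hs]
    · simp [hi]
  refine ⟨(heq _ le_rfl).symm ▸ hx.1, fun l hl hkl => ?_⟩
  rw [heq _ (ht hk hl hkl.le)]
  exact hx.2 l hl hkl

variable {μ : Measure Ω} {p : ι → Ω → ℝ}

/-- Independence of the coordinates in `S` from those outside `S`, for superuniform variables. -/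
lemma measureReal_inter_le_mul_pow [DecidableEq ι] (hm : ∀ i, Measurable (p i))
    (hind : iIndepFun p μ) {s : ℝ} (hsup : ∀ i, μ.real {ω | p i ω ≤ s} ≤ s) (S : Finset ι) {A : Set (ι → ℝ)}
    (hA : MeasurableSet A) :
    μ.real ({ω | S.piecewise (0 : ι → ℝ) (fun i => p i ω) ∈ A} ∩ {ω | ∀ i ∈ S, p i ω ≤ s})
      ≤ μ.real {ω | S.piecewise (0 : ι → ℝ) (fun i => p i ω) ∈ A} * s ^ S.card := by
  have hI := hind.indepFun_finset S Sᶜ disjoint_compl_right hm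
  set φ : ((Sᶜ : Finset ι) → ℝ) → ι → ℝ :=
    fun y i => if h : i ∈ Sᶜ then y ⟨i, h⟩ else 0 with hφ
  have hφm : Measurable φ := by
    refine measurable_pi_lambda _ fun i => ?_
    by_cases h : i ∈ Sᶜ
    · simp only [hφ, h, dite_true]; exact measurable_pi_apply _
    · simp only [hφ, h, dite_false]; exact measurable_const
  have e1 : {ω | S.piecewise (0 : ι → ℝ) (fun i => p i ω) ∈ A}
      = (fun ω (i : (Sᶜ : Finset ι)) => p i ω) ⁻¹' (φ ⁻¹' A) := by
    ext ω
    have : S.piecewise (0 : ι → ℝ) (fun i => p i ω) = φ (fun i : (Sᶜ : Finset ι) => p i ω) := by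
      ext i
      by_cases h : i ∈ S <;> simp [hφ, h]
    simp [this]
  have e2 : {ω | ∀ i ∈ S, p i ω ≤ s}
      = (fun ω (i : S) => p i ω) ⁻¹' (Set.univ.pi fun _ : S => Set.Iic s) := by
    ext ω; simp [Pi.le_def]
  have e3 : {ω | ∀ i ∈ S, p i ω ≤ s} = ⋂ i ∈ S, p i ⁻¹' Set.Iic s := by
    ext ω; simp
  have hprod : μ.real {ω | ∀ i ∈ S, p i ω ≤ s} ≤ s ^ S.card := by
    rw [e3, measureReal_def, hind.measure_inter_preimage_eq_mul S (fun _ _ => measurableSet_Iic),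
      ENNReal.toReal_prod]
    calc ∏ i ∈ S, (μ (p i ⁻¹' Set.Iic s)).toReal ≤ ∏ _i ∈ S, s :=
          Finset.prod_le_prod (fun _ _ => ENNReal.toReal_nonneg) fun i _ => hsup i
      _ = s ^ S.card := by simp
  have hmul := hI.symm.measure_inter_preimage_eq_mul (φ ⁻¹' A) (Set.univ.pi fun _ : S => Set.Iic s)
    (hφm hA) (MeasurableSet.univ_pi fun _ => measurableSet_Iic)
  rw [← e1, ← e2] at hmul
  rw [measureReal_def, hmul, ENNReal.toReal_mul]
  exact mul_le_mul_of_nonneg_left hprod ENNReal.toReal_nonneg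

/-- Maximal inequality for the reverse martingale `(1 + β / s) ^ countLE p s`: if its value at a
crossing of level `k` at `t k` is at least `K`, then crossings are unlikely. -/
theorem mul_measureReal_exists_le_countLE_le [IsProbabilityMeasure μ]
    (hm : ∀ i, Measurable (p i)) (hind : iIndepFun p μ)
    {J : Finset ℕ} {t : ℕ → ℝ} (ht : MonotoneOn t J) (ht0 : ∀ k ∈ J, 0 < t k)
    (hsup : ∀ k ∈ J, ∀ i, μ.real {ω | p i ω ≤ t k} ≤ t k) {β K : ℝ} (hβ : 0 ≤ β) (hK : 0 ≤ K)
    (hcross : ∀ k ∈ J, K ≤ (1 + β / t k) ^ k) :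
    K * μ.real {ω | ∃ k ∈ J, k ≤ countLE (fun i => p i ω) (t k)}
      ≤ (1 + β) ^ Fintype.card ι := by
  classical
  have hpm : Measurable fun ω i => p i ω := measurable_pi_lambda _ hm
  have hzm : ∀ S : Finset ι, Measurable fun ω => S.piecewise (0 : ι → ℝ) (fun i => p i ω) := by
    intro S
    refine measurable_pi_lambda _ fun i => ?_
    by_cases h : i ∈ S
    · simp [h]
    · simpa [h] using hm i
  set A : ℕ → Set Ω := fun k => {ω | (fun i => p i ω) ∈ lastCrossing J t k} with hAdef
  have hAm : ∀ k, MeasurableSet (A k) := fun k => hpm (measurableSet_lastCrossing J t k)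
  have hCm : ∀ (S : Finset ι) s, MeasurableSet {ω | ∀ i ∈ S, p i ω ≤ s} := by
    intro S s
    have : {ω | ∀ i ∈ S, p i ω ≤ s} = ⋂ i ∈ S, p i ⁻¹' Set.Iic s := by ext; simp
    rw [this]
    exact Finset.measurableSet_biInter _ fun i _ => hm i measurableSet_Iic
  set Z : Finset ι → ℕ → Set Ω :=
    fun S k => {ω | S.piecewise (0 : ι → ℝ) (fun i => p i ω) ∈ lastCrossing J t k} with hZdef
  -- On `A k`, `K` is at most the power of `1 + β / t k` with exponent the count, which expands as a
  -- sum over subsets `S` of the coordinates below `t k`.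
  have hexpand : ∀ k ∈ J, K * μ.real (A k)
      ≤ ∑ S : Finset ι, (β / t k) ^ S.card * μ.real (A k ∩ {ω | ∀ i ∈ S, p i ω ≤ t k}) := by
    intro k hk
    have hb : 0 ≤ β / t k := div_nonneg hβ (ht0 k hk).le
    have hBm := fun S : Finset ι => (hAm k).inter (hCm S (t k))
    have hint : ∀ (B : Set Ω) (a : ℝ), MeasurableSet B →
        Integrable (B.indicator fun _ => a) μ := fun B a hB =>
      (integrable_const a).indicator hB
    have hval : ∀ (B : Set Ω) (a : ℝ), MeasurableSet B →
        ∫ ω, B.indicator (fun _ => a) ω ∂μ = a * μ.real B := fun B a hB => by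
      rw [integral_indicator_const a hB, smul_eq_mul, mul_comm]
    rw [← hval _ _ (hAm k), ← Finset.sum_congr rfl fun S _ => hval _ _ (hBm S),
      ← integral_finsetSum _ fun S _ => hint _ _ (hBm S)]
    refine integral_mono (hint _ _ (hAm k)) (integrable_finsetSum _ fun S _ => hint _ _ (hBm S))
      fun ω => ?_
    by_cases hω : ω ∈ A k
    · rw [Set.indicator_of_mem hω]
      set T := Finset.univ.filter fun i => p i ω ≤ t k with hT
      have hind' : ∀ S : Finset ι,
          (A k ∩ {ω | ∀ i ∈ S, p i ω ≤ t k}).indicator (fun _ => (β / t k) ^ S.card) ω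
            = if S ∈ T.powerset then (β / t k) ^ S.card else 0 := by
        intro S
        have : ω ∈ A k ∩ {ω | ∀ i ∈ S, p i ω ≤ t k} ↔ S ∈ T.powerset := by
          rw [Finset.mem_powerset, Finset.subset_iff]
          simp [hT, hω]
        by_cases h : S ∈ T.powerset
        · rw [if_pos h, Set.indicator_of_mem (this.2 h)]
        · rw [if_neg h, Set.indicator_of_notMem (mt this.1 h)]
      simp only [hind']
      rw [Finset.sum_ite_mem, Finset.univ_inter]
      have hsum := Finset.sum_pow_mul_eq_add_pow (β / t k) 1 T
      simp only [one_pow, mul_one] at hsum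
      rw [hsum, add_comm]
      exact (hcross k hk).trans (pow_le_pow_right₀ (by linarith) hω.1)
    · rw [Set.indicator_of_notMem hω]
      exact Finset.sum_nonneg fun S _ => Set.indicator_nonneg (fun _ _ => by positivity) _
  -- Zeroing the coordinates in `S` makes the crossing event independent of them; the factor `t k ^
  -- S.card` then cancels the denominator.
  have hterm : ∀ k ∈ J, ∀ S : Finset ι,
      (β / t k) ^ S.card * μ.real (A k ∩ {ω | ∀ i ∈ S, p i ω ≤ t k})
        ≤ β ^ S.card * μ.real (Z S k) := by
    intro k hk S
    have hb : 0 ≤ β / t k := div_nonneg hβ (ht0 k hk).le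
    have hsub : A k ∩ {ω | ∀ i ∈ S, p i ω ≤ t k} ⊆ Z S k ∩ {ω | ∀ i ∈ S, p i ω ≤ t k} :=
      fun ω hω => ⟨piecewise_zero_mem_lastCrossing ht ht0 hk hω.1 hω.2, hω.2⟩
    calc (β / t k) ^ S.card * μ.real (A k ∩ {ω | ∀ i ∈ S, p i ω ≤ t k})
        ≤ (β / t k) ^ S.card * (μ.real (Z S k) * t k ^ S.card) :=
          mul_le_mul_of_nonneg_left ((measureReal_mono hsub).trans
            (measureReal_inter_le_mul_pow hm hind (hsup k hk) S
              (measurableSet_lastCrossing J t k))) (by positivity)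
      _ = β ^ S.card * μ.real (Z S k) := by
          rw [div_pow]
          have := (pow_pos (ht0 k hk) S.card).ne'
          field_simp
  -- Last crossings at distinct levels stay disjoint after zeroing, so no union bound over `k` is
  -- lost.
  have hZsum : ∀ S : Finset ι, ∑ k ∈ J, μ.real (Z S k) ≤ 1 := by
    intro S
    have hdisj : Set.PairwiseDisjoint (J : Set ℕ) (Z S) := fun k hk l hl hkl =>
      (disjoint_lastCrossing hk hl hkl).preimage _
    rw [← measureReal_biUnion_finset hdisj
      fun k _ => hzm S (measurableSet_lastCrossing J t k)]
    exact measureReal_le_one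
  have hunion : {ω | ∃ k ∈ J, k ≤ countLE (fun i => p i ω) (t k)} ⊆ ⋃ k ∈ J, A k := by
    intro ω hω
    simpa [hAdef] using exists_mem_lastCrossing hω
  calc K * μ.real {ω | ∃ k ∈ J, k ≤ countLE (fun i => p i ω) (t k)}
      ≤ K * ∑ k ∈ J, μ.real (A k) := mul_le_mul_of_nonneg_left
        ((measureReal_mono hunion (measure_ne_top _ _)).trans (measureReal_biUnion_finset_le _ _)) hK
    _ = ∑ k ∈ J, K * μ.real (A k) := Finset.mul_sum _ _ _
    _ ≤ ∑ k ∈ J, ∑ S : Finset ι, β ^ S.card * μ.real (Z S k) :=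
        Finset.sum_le_sum fun k hk => (hexpand k hk).trans
          (Finset.sum_le_sum fun S _ => hterm k hk S)
    _ = ∑ S : Finset ι, β ^ S.card * ∑ k ∈ J, μ.real (Z S k) := by
        rw [Finset.sum_comm]
        simp only [Finset.mul_sum]
    _ ≤ ∑ S : Finset ι, β ^ S.card * 1 :=
        Finset.sum_le_sum fun S _ => mul_le_mul_of_nonneg_left (hZsum S) (by positivity)
    _ = (1 + β) ^ Fintype.card ι := by
        have hsum := Finset.sum_pow_mul_eq_add_pow β 1 (Finset.univ : Finset ι)
        simp only [one_pow, mul_one, Finset.powerset_univ, Finset.card_univ] at hsum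
        simp only [mul_one]
        rw [hsum, add_comm]

end crossing

/-! ### From a failed bound to a crossing. -/

lemma orderStat_nonneg {n : ℕ} {x : Fin n → ℝ} (hx : ∀ j, 0 ≤ x j) (k : Fin n) :
    0 ≤ orderStat x k := hx _

/-- If the bound fails at `k`, then more than `log(1/α) / log(1 + log(1/α)) * (1 + n p_(k))` null
p-values are at most `p_(k)`. -/
lemma lt_card_of_FDPbarSort_lt_FDP {n : ℕ} {H₀ : Finset (Fin n)} {α : ℝ} {x : Fin n → ℝ}
    {k : Fin n} (h : FDPbarSort α x k < FDP H₀ (sortedPath x k)) :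
    Real.log (1 / α) / Real.log (1 + Real.log (1 / α)) * (1 + (n : ℝ) * orderStat x k)
      < ((sortedPath x k ∩ H₀).card : ℝ) := by
  have hpos : 0 < ((sortedPath x k).card : ℝ) := by
    refine Nat.cast_pos.2 (Finset.card_pos.2 ⟨Tuple.sort x k, ?_⟩)
    exact Finset.mem_filter.2 ⟨Finset.mem_univ _, le_rfl⟩
  rw [FDPbarSort, FDP, div_lt_div_iff_of_pos_right hpos] at h
  have h' : VbarSort α x k < ((sortedPath x k ∩ H₀).card : ℤ) := by exact_mod_cast h
  rw [VbarSort, Int.floor_lt] at h'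
  exact_mod_cast h'

lemma card_sortedPath_inter_le_countLE {n : ℕ} {H₀ : Finset (Fin n)} {x : Fin n → ℝ} {k : Fin n}
    {s : ℝ} (hs : orderStat x k ≤ s) :
    (sortedPath x k ∩ H₀).card ≤ countLE (fun j : {j : Fin n // j ∈ H₀} => x j) s := by
  rw [countLE, ← Finset.card_map (Function.Embedding.subtype _)]
  refine Finset.card_le_card fun j hj => ?_
  simp only [sortedPath, Finset.mem_inter, Finset.mem_filter, Finset.mem_univ, true_and] at hj
  simp [hj.2, hj.1.trans hs]

end SimultaneousFDP

open SimultaneousFDP in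
theorem theorem1 {Ω : Type*} [MeasurableSpace Ω] (μ : Measure Ω) [IsProbabilityMeasure μ]
    (n : ℕ) (H₀ : Finset (Fin n)) (p : Fin n → Ω → ℝ)
    (hp_meas : ∀ j, Measurable (p j))
    (hp_range : ∀ j ω, p j ω ∈ Set.Icc (0 : ℝ) 1)
    (h_indep : iIndepFun (fun j : {j : Fin n // j ∈ H₀} => p j) μ)
    (h_super : ∀ j ∈ H₀, ∀ s ∈ Set.Icc (0 : ℝ) 1, μ.real {ω | p j ω ≤ s} ≤ s)
    (α : ℝ) (hα : α ∈ Set.Ioc (0 : ℝ) 0.31) :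
    1 - α ≤ μ.real {ω | ∀ k : Fin n,
      SimultaneousFDP.FDP H₀ (SimultaneousFDP.sortedPath (fun j => p j ω) k)
        ≤ SimultaneousFDP.FDPbarSort α (fun j => p j ω) k} := by
  obtain ⟨hα0, hα1⟩ := hα
  rcases Nat.eq_zero_or_pos n with rfl | hn
  · simp [hα0.le]
  have hn0 : (0 : ℝ) < n := Nat.cast_pos.2 hn
  set u := Real.log (1 / α) with hu
  have hu0 : 0 < u := Real.log_pos (by rw [lt_div_iff₀ hα0]; norm_num at hα1; linarith)
  have hexpu : Real.exp (-u) = α := by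
    rw [hu, one_div, Real.log_inv, neg_neg, Real.exp_log hα0]
  obtain ⟨g, hg, hline⟩ := exists_add_le_mul_log_one_add_div hu0
  set c := u / Real.log (1 + u) with hc
  have hc1 : 1 ≤ c := by
    rw [hc, one_le_div (Real.log_pos (by linarith))]
    linarith [Real.log_le_sub_one_of_pos (x := 1 + u) (by linarith)]
  have hc0 : 0 < c := by linarith
  set t : ℕ → ℝ := fun k => (k / c - 1) / n with ht
  -- Levels with `t k ≤ 0` can be dropped: a failure at level `a` has `0 ≤ s < t a`.
  set J := (Finset.range (n + 1)).filter fun k => 0 < t k with hJ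
  have hk_eq : ∀ k : ℕ, (k : ℝ) = c * (1 + n * t k) := by
    intro k
    simp only [ht]
    field_simp
    ring
  have hbad := mul_measureReal_exists_le_countLE_le (μ := μ)
    (p := fun j : {j : Fin n // j ∈ H₀} => p j) (fun j => hp_meas j) h_indep (J := J) (t := t)
    (fun k _ l _ hkl => by
      simp only [ht]
      gcongr)
    (fun k hk => (Finset.mem_filter.1 hk).2)
    (fun k hk j => by
      rw [hJ, Finset.mem_filter, Finset.mem_range] at hk
      refine h_super j j.2 _ ⟨hk.2.le, ?_⟩
      have hkn : (k : ℝ) ≤ n := by exact_mod_cast Nat.lt_succ_iff.1 hk.1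
      have : (k : ℝ) / c ≤ k := div_le_self (by positivity) hc1
      rw [div_le_one hn0]
      linarith)
    (β := g / n) (K := Real.exp (u + g)) (by positivity) (by positivity)
    (fun k hk => by
      have htk := (Finset.mem_filter.1 hk).2
      have h1 : 0 < 1 + g / n / t k := by positivity
      have h2 := hline (n * t k) (by positivity)
      rw [← hk_eq, ← div_div] at h2
      calc Real.exp (u + g) ≤ Real.exp (k * Real.log (1 + g / n / t k)) := Real.exp_le_exp.2 h2
        _ = _ := by rw [Real.exp_nat_mul, Real.exp_log h1])
  set B := {ω | ∃ k ∈ J, k ≤ countLE (fun j : {j : Fin n // j ∈ H₀} => p j ω) (t k)} with hB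
  have hBα : μ.real B ≤ α := by
    have h1 : (1 + g / n) ^ Fintype.card {j : Fin n // j ∈ H₀} ≤ Real.exp g := by
      have hcard : Fintype.card {j : Fin n // j ∈ H₀} ≤ n := by
        simpa using Finset.card_le_univ H₀
      calc (1 + g / n) ^ Fintype.card {j : Fin n // j ∈ H₀} ≤ (1 + g / n) ^ n :=
            pow_le_pow_right₀ (by linarith [div_pos hg hn0]) hcard
        _ ≤ Real.exp (g / n) ^ n := by
            gcongr
            linarith [Real.add_one_le_exp (g / n)]
        _ = Real.exp g := by rw [← Real.exp_nat_mul, mul_div_cancel₀ _ hn0.ne']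
    have h2 := hbad.trans h1
    calc μ.real B = Real.exp (-(u + g)) * (Real.exp (u + g) * μ.real B) := by
          rw [← mul_assoc, ← Real.exp_add]; simp
      _ ≤ Real.exp (-(u + g)) * Real.exp g := by gcongr
      _ = α := by rw [← Real.exp_add, ← hexpu]; congr 1; ring
  set E := {ω | ∀ k : Fin n, FDP H₀ (sortedPath (fun j => p j ω) k)
    ≤ FDPbarSort α (fun j => p j ω) k}
  have hcover : (Set.univ : Set Ω) ⊆ E ∪ B := by
    intro ω _
    by_contra! hω
    rw [Set.mem_union, not_or] at hω
    obtain ⟨hE, hnB⟩ := hω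
    refine hnB ?_
    obtain ⟨k, hk⟩ : ∃ k : Fin n, FDPbarSort α (fun j => p j ω) k
        < FDP H₀ (sortedPath (fun j => p j ω) k) := by
      by_contra! h
      exact hE h
    have hlt := lt_card_of_FDPbarSort_lt_FDP hk
    set a := (sortedPath (fun j => p j ω) k ∩ H₀).card
    set s := orderStat (fun j => p j ω) k with hs
    have hs0 : 0 ≤ s := orderStat_nonneg (fun j => (hp_range j ω).1) k
    rw [← hu, ← hc, hk_eq a] at hlt
    have hst : s < t a := by
      have := lt_of_mul_lt_mul_left hlt hc0.le
      exact lt_of_mul_lt_mul_left (by linarith) hn0.le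
    have han : a ≤ n := by
      simpa using Finset.card_le_univ (sortedPath (fun j => p j ω) k ∩ H₀)
    exact ⟨a, Finset.mem_filter.2 ⟨Finset.mem_range.2 (by omega), hs0.trans_lt hst⟩,
      card_sortedPath_inter_le_countLE hst.le⟩
  have h1 : (1 : ℝ) ≤ μ.real E + μ.real B := by
    rw [← probReal_univ (μ := μ)]
    exact (measureReal_mono hcover).trans (measureReal_union_le _ _)
  linarith
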